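/- **Theorem (upper bound for the spiked covariance model).** For integers $1\le k\le n$ and $0<\epsilon\le 1$, the spiked covariance model is the distribution of the random signal $x=y+z\in\mathbb{R}^n$, where $y$ is supported on a uniformly random set of $k$ coordinates, its values on this set are independent and uniform on $\{-\sqrt{\epsilon/k},+\sqrt{\epsilon/k}\}$, and $z\sim N(0,\frac1n I_n)$ is independent of $y$. Write $x_{-k}$ for the vector $x$ with its $k$ coordinates of largest magnitude set to zero (ties broken arbitrarily). A recovery system with $m$ measurements consists of a probability distribution $\mathcal{D}$ on $\mathbb{R}^{m\times n}$ and a measurable map $\mathcal{R}\colon\mathbb{R}^{m\times n}\times\mathbb{R}^m\to\mathbb{R}^n$. For every constant $\beta\in(0,1)$ there is a constant $C>0$, depending only on $\beta$, such that the following holds for all integers $1\le k\le n$ and all reals $\epsilon\in(0,1]$, $\delta\in(0,1)$ with $$\frac{k}{\epsilon}\le\beta n\qquad\text{and}\qquad\frac{k}{\epsilon}\log\frac1\delta\le\beta n$$ (the first condition follows from the second when $\delta\le 1/e$). There is a recovery system $(\mathcal{D},\mathcal{R})$ with $$m\le C\left(\frac{k}{\epsilon}\log\frac{\epsilon n}{k}+\frac1\epsilon\log\frac1\delta\right)$$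 measurements such that, for $\Phi\sim\mathcal{D}$ and an independent signal $x$ from the spiked covariance model, the output $\hat x=\mathcal{R}(\Phi,\Phi x)$ satisfies $\|\hat x-x\|_2^2\le(1+\epsilon)\|x_{-k}\|_2^2$ with probability at least $1-\delta$ over both $\Phi$ and $x$. -/

import Mathlib

open MeasureTheory ProbabilityTheory

/-- The squared Euclidean norm of a vector in `ℝⁿ`. -/
def sqNorm {n : ℕ} (x : Fin n → ℝ) : ℝ := ∑ i, x i ^ 2

/-- `H` is a set of `k` coordinates of `x` of largest magnitude (any way of breaking ties). -/
def IsTopSet {n : ℕ} (k : ℕ) (x : Fin n → ℝ) (H : Finset (Fin n)) : Prop :=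
  H.card = k ∧ ∀ i ∈ H, ∀ j ∉ H, |x j| ≤ |x i|

/-- The vector `x` with all the coordinates in `H` set to zero. -/
def zeroOn {n : ℕ} (H : Finset (Fin n)) (x : Fin n → ℝ) : Fin n → ℝ :=
  fun i => if i ∈ H then 0 else x i

/-- The sparse vector with support `S`, with value `√(ε/k)` at the `i ∈ S` with `σ i = true`
and `-√(ε/k)` at the `i ∈ S` with `σ i = false`. -/
noncomputable def spikeVector {n : ℕ} (k : ℕ) (ε : ℝ) (S : Finset (Fin n)) (σ : Fin n → Bool) :
    Fin n → ℝ :=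
  fun i => if i ∈ S then (if σ i then √(ε / k) else -√(ε / k)) else 0

/-- The Gaussian measure `N(0, I/n)` on `ℝⁿ`: independent coordinates, each of variance `1/n`. -/
noncomputable def noiseLaw (n : ℕ) : Measure (Fin n → ℝ) :=
  Measure.pi fun _ => gaussianReal 0 ((n : NNReal)⁻¹)

/-- The law of the signal `x = y + z` in the spiked covariance model. The support of `y` is a
uniformly random set of `k` coordinates, its signs are independent and uniform, and the noise `z`
with law `N(0, I/n)` is independent of `y`; so the law of `x` is the uniform mixture, over all
supports and sign patterns, of the laws of `y + z` with `y` fixed. -/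
noncomputable def spikedLaw (n k : ℕ) (ε : ℝ) : Measure (Fin n → ℝ) :=
  ((n.choose k : ENNReal) * 2 ^ n)⁻¹ •
    ∑ S ∈ Finset.powersetCard k (Finset.univ : Finset (Fin n)), ∑ σ : Fin n → Bool,
      (noiseLaw n).map fun z => spikeVector k ε S σ + z

/-- The Borel (product) structure on real matrices, seen as arrays of entries. -/
instance matrixMeasurableSpace (m n : ℕ) : MeasurableSpace (Matrix (Fin m) (Fin n) ℝ) :=
  inferInstanceAs (MeasurableSpace (Fin m → Fin n → ℝ))

/-- A recovery system with `m` measurements of signals in `ℝⁿ`: a distribution on the `m × n`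
measurement matrices `Φ`, and a recovery algorithm with input `Φ` and the measurements `Φ x`. -/
structure RecoverySystem (n m : ℕ) where
  dist : Measure (Matrix (Fin m) (Fin n) ℝ)
  isProbabilityMeasure_dist : IsProbabilityMeasure dist
  recover : Matrix (Fin m) (Fin n) ℝ → (Fin m → ℝ) → (Fin n → ℝ)
  measurable_recover : Measurable (Function.uncurry recover)

/-- The matrix `p.1` and the signal `p.2` are such that the output of the recovery algorithm
satisfies the `ℓ₂/ℓ₂` guarantee `‖x̂ - x‖² ≤ (1 + ε) ‖x₋ₖ‖²`, where `x₋ₖ` is `x` with its `k`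
largest coordinates removed. -/
def RecoverySystem.Succeeds {n m : ℕ} (A : RecoverySystem n m) (k : ℕ) (ε : ℝ)
    (p : Matrix (Fin m) (Fin n) ℝ × (Fin n → ℝ)) : Prop :=
  ∀ H : Finset (Fin n), IsTopSet k p.2 H →
    sqNorm (A.recover p.1 (p.1.mulVec p.2) - p.2) ≤ (1 + ε) * sqNorm (zeroOn H p.2)

/-- The system achieves the `ℓ₂/ℓ₂` guarantee in the spiked covariance model with failure
probability at most `δ`, over the independent choices of the matrix and of the signal. -/
def RecoverySystem.SolvesSpiked {n m : ℕ} (A : RecoverySystem n m) (k : ℕ) (ε δ : ℝ) : Prop :=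
  ENNReal.ofReal (1 - δ) ≤ (A.dist.prod (spikedLaw n k ε)) {p | A.Succeeds k ε p}

theorem exists_isTopSet {n k : ℕ} (hk : k ≤ n) (x : Fin n → ℝ) : ∃ H, IsTopSet k x H := by
  induction k with
  | zero => exact ⟨∅, by simp [IsTopSet]⟩
  | succ k ih =>
    obtain ⟨H, hH, h⟩ := ih (by omega)
    have hne : (Hᶜ).Nonempty := by
      rw [← Finset.card_pos, Finset.card_compl, Fintype.card_fin]
      omega
    obtain ⟨a, ha, hmax⟩ := Finset.exists_max_image Hᶜ (fun i => |x i|) hne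
    rw [Finset.mem_compl] at ha
    refine ⟨insert a H, by rw [Finset.card_insert_of_notMem ha, hH], ?_⟩
    intro i hi j hj
    rw [Finset.mem_insert, not_or] at hj
    rcases Finset.mem_insert.1 hi with rfl | hi
    · exact hmax j (Finset.mem_compl.2 hj.2)
    · exact h i hi j hj.2

theorem isProbabilityMeasure_spikedLaw {n k : ℕ} (hk : k ≤ n) (ε : ℝ) :
    IsProbabilityMeasure (spikedLaw n k ε) := by
  have hmap (S : Finset (Fin n)) (σ : Fin n → Bool) :
      ((noiseLaw n).map fun z => spikeVector k ε S σ + z) Set.univ = 1 := by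
    have : IsProbabilityMeasure (noiseLaw n) := by unfold noiseLaw; infer_instance
    have := Measure.isProbabilityMeasure_map (μ := noiseLaw n)
      (f := fun z => spikeVector k ε S σ + z) (by fun_prop)
    exact measure_univ
  refine ⟨?_⟩
  have h0 : ((n.choose k : ENNReal) * 2 ^ n) ≠ 0 := by
    simp [Nat.choose_eq_zero_iff, hk]
  have h1 : ((n.choose k : ENNReal) * 2 ^ n) ≠ ⊤ :=
    ENNReal.mul_ne_top (by simp) (by simp)
  simp only [spikedLaw, Measure.smul_apply, Measure.finsetSum_apply, hmap, smul_eq_mul]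
  simpa using ENNReal.inv_mul_cancel h0 h1

/-! Put `r = εn/k` and `L = k log r + log (1/δ)`; the target is `m = O(L/ε)`. Three regimes are
treated separately.

If `L` is at least a constant times `εn`, reading all `n` coordinates is affordable and exact.

If `L` is small and `εr ≥ 1`, then `log (n/k) ≤ 2 log r`, so there are at most `e^{4L}` possible
sparse parts. A Gaussian `Φ` is used, and the decoder returns the candidate `y'` minimizing `‖Φx -
Φy'‖`. Every set of `k` coordinates carries only `O(ε)` of the noise energy, so the noise is almost
orthogonal to `d = y - y'`. Hence a candidate with `‖d‖² ≥ ε/8` beats `y` with probability at most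
`(1 + ‖d‖²/64)^{-m/2} ≤ e^{-5L}` (`gaussianMatrix_prod_noiseLaw_le`), which survives the union
bound. A close candidate already meets the guarantee, because `‖x₋ₖ‖²` is about `‖z‖² ≥ 1/2` and
leaves slack of order `ε` (`sqNorm_sub_le_of_close`).

If `L` is small and `εr ≤ 1`, that count may be too large, but `εn ≤ k/ε ≤ L/ε`. It then suffices to
read the first `m` coordinates: they hold noise energy of order `m/n`, more than any `k` coordinates
of `x` hold, so the error is at most `‖x₋ₖ‖²` (`coordinateSystem_solvesSpiked_of_le`). -/

/-! ### Exponential moments and the Chernoff bound. -/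

theorem integral_exp_mul_sq_gaussianReal (v : NNReal) {c : ℝ} (hc : 2 * c * v < 1) :
    Integrable (fun x => Real.exp (c * x ^ 2)) (gaussianReal 0 v) ∧
      ∫ x, Real.exp (c * x ^ 2) ∂gaussianReal 0 v = (√(1 - 2 * c * v))⁻¹ := by
  rcases eq_or_ne v 0 with rfl | hv
  · simp only [gaussianReal_zero_var]
    exact ⟨integrable_dirac (by finiteness), by simp⟩
  have hv' : (0 : ℝ) < v := by positivity
  set b : ℝ := (1 - 2 * c * v) / (2 * v) with hb
  have hbpos : 0 < b := by apply div_pos <;> linarith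
  have hpdf (x : ℝ) : gaussianPDFReal 0 v x * Real.exp (c * x ^ 2) =
      (√(2 * Real.pi * v))⁻¹ * Real.exp (-b * x ^ 2) := by
    rw [gaussianPDFReal, mul_assoc, ← Real.exp_add]
    congr 2
    rw [hb]
    field_simp
    ring
  constructor
  · rw [gaussianReal_of_var_ne_zero _ hv, gaussianPDF_def,
      integrable_withDensity_iff_integrable_smul₀' (by fun_prop) (by simp)]
    simp only [smul_eq_mul, ENNReal.toReal_ofReal (gaussianPDFReal_nonneg _ _ _), hpdf]
    exact (integrable_exp_neg_mul_sq hbpos).const_mul _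
  · rw [integral_gaussianReal_eq_integral_smul hv]
    simp only [smul_eq_mul, hpdf]
    rw [integral_const_mul, integral_gaussian, ← Real.sqrt_inv, ← Real.sqrt_inv,
      ← Real.sqrt_mul (by positivity)]
    congr 1
    have : 1 - 2 * c * v ≠ 0 := by linarith
    rw [hb]
    field_simp

theorem measure_nonneg_le_integral_exp {α : Type*} [MeasurableSpace α] {μ : Measure α}
    [IsFiniteMeasure μ] {f : α → ℝ} (hf : Integrable (fun x => Real.exp (f x)) μ) :
    μ {x | 0 ≤ f x} ≤ ENNReal.ofReal (∫ x, Real.exp (f x) ∂μ) := by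
  have h := measure_ge_le_exp_mul_mgf (X := f) (μ := μ) 0 zero_le_one (by simpa using hf)
  simp only [mul_zero, Real.exp_zero, one_mul, mgf] at h
  rw [← ofReal_measureReal]
  exact ENNReal.ofReal_le_ofReal h

/-- Chernoff bound for a sum over independent coordinates. -/
theorem pi_measure_sum_nonneg_le {ι α : Type*} [Fintype ι] [MeasurableSpace α] {μ : Measure α}
    [IsProbabilityMeasure μ] {f : ι → α → ℝ} {ρ : ι → ℝ} (a : ℝ)
    (hf : ∀ i, Integrable (fun x => Real.exp (f i x)) μ)
    (hρ : ∀ i, ∫ x, Real.exp (f i x) ∂μ ≤ ρ i) :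
    Measure.pi (fun _ : ι => μ) {x | a ≤ ∑ i, f i (x i)} ≤
      ENNReal.ofReal (Real.exp (-a) * ∏ i, ρ i) := by
  have hexp (x : ι → α) : Real.exp (-a + ∑ i, f i (x i)) =
      Real.exp (-a) * ∏ i, Real.exp (f i (x i)) := by
    rw [Real.exp_add, Real.exp_sum]
  have hint : Integrable (fun x : ι → α => Real.exp (-a + ∑ i, f i (x i)))
      (Measure.pi fun _ => μ) := by
    simp only [hexp]
    exact (Integrable.fintype_prod (𝕜 := ℝ) hf).const_mul _
  have h := measure_nonneg_le_integral_exp hint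
  simp only [le_neg_add_iff_add_le, add_zero] at h
  refine h.trans (ENNReal.ofReal_le_ofReal ?_)
  simp only [hexp]
  rw [integral_const_mul, integral_fintype_prod_eq_prod (fun i x => Real.exp (f i x))]
  exact mul_le_mul_of_nonneg_left (Finset.prod_le_prod
    (fun i _ => integral_nonneg fun _ => (Real.exp_pos _).le) fun i _ => hρ i) (Real.exp_pos _).le

/-! ### Comparing `‖Φ(z + d)‖` with `‖Φz‖` for a Gaussian matrix. -/

theorem indepFun_inner_stdGaussian {n : ℕ} {u w : EuclideanSpace ℝ (Fin n)}
    (h : inner ℝ u w = 0) :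
    IndepFun (fun g => inner ℝ u g) (fun g => inner ℝ w g)
      (stdGaussian (EuclideanSpace ℝ (Fin n))) := by
  apply HasGaussianLaw.indepFun_of_covariance_eq_zero
  · exact (IsGaussian.hasGaussianLaw_id (μ := stdGaussian (EuclideanSpace ℝ (Fin n)))).map_fun
      ((innerSL ℝ u).prod (innerSL ℝ w))
  · rw [← covarianceBilin_apply_eq_cov (IsGaussian.memLp_two_id), covarianceBilin_stdGaussian]
    exact h

theorem map_inner_stdGaussian {n : ℕ} (u : EuclideanSpace ℝ (Fin n)) :
    (stdGaussian (EuclideanSpace ℝ (Fin n))).map (fun g => inner ℝ u g) =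
      gaussianReal 0 (‖u‖₊ ^ 2) := by
  have h := (IsGaussian.hasGaussianLaw_id
    (μ := stdGaussian (EuclideanSpace ℝ (Fin n)))).map_fun (innerSL ℝ u)
  have h2 := h.map_eq_gaussianReal
  have h3 := integral_strongDual_stdGaussian (innerSL ℝ u)
  have h4 := variance_dual_stdGaussian (innerSL ℝ u)
  simp only [id_eq, innerSL_apply_apply] at h2
  rw [h2]
  congr 1
  simp only [innerSL_apply_norm] at h4
  change Real.toNNReal (Var[fun ω => innerSL ℝ u ω; _]) = _
  rw [h4]
  ext
  simp

/-- Split `z = αd + w` with `w ⊥ d`. The exponent becomes a quadratic in the independent Gaussians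
`⟨d, g⟩` and `⟨w, g⟩`, linear in the second. Integrating `⟨w, g⟩` out costs at most half of the
negative square of `⟨d, g⟩`, since `‖w‖² ≤ 4` and `1 + 2α ≥ 1/2`; the rest is a Gaussian integral.
-/
theorem integral_exp_inner_sq_sub_le {n : ℕ} {z d : EuclideanSpace ℝ (Fin n)}
    (hz : ‖z‖ ^ 2 ≤ 4) (hzd : 4 * |inner ℝ z d| ≤ ‖d‖ ^ 2) :
    Integrable (fun g => Real.exp ((1 / 32) * (inner ℝ z g ^ 2 - inner ℝ (z + d) g ^ 2)))
        (stdGaussian (EuclideanSpace ℝ (Fin n))) ∧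
      ∫ g, Real.exp ((1 / 32) * (inner ℝ z g ^ 2 - inner ℝ (z + d) g ^ 2))
        ∂stdGaussian (EuclideanSpace ℝ (Fin n)) ≤ (√(1 + ‖d‖ ^ 2 / 64))⁻¹ := by
  rcases eq_or_ne d 0 with rfl | hd
  · simp
  have hd' : 0 < ‖d‖ ^ 2 := by positivity
  set P := stdGaussian (EuclideanSpace ℝ (Fin n))
  set α : ℝ := inner ℝ z d / ‖d‖ ^ 2 with hα
  set w := z - α • d with hw
  have hαd : α * ‖d‖ ^ 2 = inner ℝ z d := by rw [hα]; field_simp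
  have horth : inner ℝ d w = 0 := by
    rw [hw, inner_sub_right, inner_smul_right, real_inner_self_eq_norm_sq, hαd,
      real_inner_comm, sub_self]
  have hzw : z = α • d + w := by rw [hw]; abel
  have hαb : |α| ≤ 1 / 4 := by
    rw [hα, abs_div, abs_of_pos hd', div_le_iff₀ hd']
    linarith
  have hα4 : 1 / 2 ≤ 1 + 2 * α := by
    have := neg_abs_le α
    linarith
  have hwb : ‖w‖ ^ 2 ≤ 4 := by
    have : ‖z‖ ^ 2 = ‖α • d‖ ^ 2 + ‖w‖ ^ 2 := by
      conv_lhs => rw [hzw]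
      rw [norm_add_sq_real, inner_smul_left, horth]
      simp
    nlinarith [sq_nonneg ‖α • d‖]
  set F : ℝ × ℝ → ℝ := fun p => Real.exp (-(1 / 32) * ((1 + 2 * α) * p.1 ^ 2 + 2 * p.1 * p.2))
    with hF
  have hfun (g : EuclideanSpace ℝ (Fin n)) :
      Real.exp ((1 / 32) * (inner ℝ z g ^ 2 - inner ℝ (z + d) g ^ 2)) =
        F (inner ℝ d g, inner ℝ w g) := by
    have : inner ℝ z g = α * inner ℝ d g + inner ℝ w g := by
      conv_lhs => rw [hzw]
      rw [inner_add_left, inner_smul_left]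
      simp
    simp only [hF, inner_add_left, this]
    congr 1
    ring
  have hmeas : Measurable fun g : EuclideanSpace ℝ (Fin n) => (inner ℝ d g, inner ℝ w g) := by
    fun_prop
  have hlaw : P.map (fun g => (inner ℝ d g, inner ℝ w g)) =
      (gaussianReal 0 (‖d‖₊ ^ 2)).prod (gaussianReal 0 (‖w‖₊ ^ 2)) := by
    rw [← map_inner_stdGaussian, ← map_inner_stdGaussian]
    exact (indepFun_iff_map_prod_eq_prod_map_map (by fun_prop) (by fun_prop)).1
      (indepFun_inner_stdGaussian horth)
  have hinner (x : ℝ) : ∫⁻ y, ENNReal.ofReal (F (x, y)) ∂gaussianReal 0 (‖w‖₊ ^ 2) ≤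
      ENNReal.ofReal (Real.exp (-(1 / 128) * x ^ 2)) := by
    have hsplit (y : ℝ) : F (x, y) =
        Real.exp (-(1 / 32) * (1 + 2 * α) * x ^ 2) * Real.exp (-(x / 16) * y) := by
      simp only [hF, ← Real.exp_add]
      congr 1
      ring
    have hi := (integrable_exp_mul_gaussianReal (μ := 0) (v := ‖w‖₊ ^ 2) (-(x / 16))).const_mul
      (Real.exp (-(1 / 32) * (1 + 2 * α) * x ^ 2))
    have hm : ∫ y, Real.exp (-(x / 16) * y) ∂gaussianReal 0 (‖w‖₊ ^ 2) =
        Real.exp (‖w‖ ^ 2 * (-(x / 16)) ^ 2 / 2) := by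
      have := congrFun (mgf_fun_id_gaussianReal (μ := 0) (v := ‖w‖₊ ^ 2)) (-(x / 16))
      simpa [mgf] using this
    simp only [hsplit]
    rw [← ofReal_integral_eq_lintegral_ofReal hi (ae_of_all _ fun _ => by positivity),
      integral_const_mul, hm, ← Real.exp_add]
    apply ENNReal.ofReal_le_ofReal
    apply Real.exp_le_exp.2
    -- The two terms are at most `-x²/64` and `4·x²/512 = x²/128`.
    nlinarith [mul_le_mul_of_nonneg_right hα4 (sq_nonneg x),
      mul_le_mul_of_nonneg_right hwb (sq_nonneg x)]
  have hlint : ∫⁻ g, ENNReal.ofReal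
      (Real.exp ((1 / 32) * (inner ℝ z g ^ 2 - inner ℝ (z + d) g ^ 2))) ∂P ≤
        ENNReal.ofReal (√(1 + ‖d‖ ^ 2 / 64))⁻¹ := by
    have h1 := integral_exp_mul_sq_gaussianReal (‖d‖₊ ^ 2) (c := -(1 / 128)) (by
      push_cast
      linarith)
    calc _ = ∫⁻ p, ENNReal.ofReal (F p) ∂(P.map fun g => (inner ℝ d g, inner ℝ w g)) := by
          rw [lintegral_map (by fun_prop) hmeas]
          simp only [hfun]
      _ = ∫⁻ x, ∫⁻ y, ENNReal.ofReal (F (x, y)) ∂gaussianReal 0 (‖w‖₊ ^ 2)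
            ∂gaussianReal 0 (‖d‖₊ ^ 2) := by
          rw [hlaw, lintegral_prod _ (by fun_prop)]
      _ ≤ ∫⁻ x, ENNReal.ofReal (Real.exp (-(1 / 128) * x ^ 2)) ∂gaussianReal 0 (‖d‖₊ ^ 2) :=
          lintegral_mono hinner
      _ = _ := by
          rw [← ofReal_integral_eq_lintegral_ofReal h1.1 (ae_of_all _ fun _ => by positivity),
            h1.2]
          push_cast
          congr 3
          ring
  have hint : Integrable
      (fun g => Real.exp ((1 / 32) * (inner ℝ z g ^ 2 - inner ℝ (z + d) g ^ 2))) P := by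
    refine (lintegral_ofReal_ne_top_iff_integrable ?_ (ae_of_all _ fun _ => by positivity)).1
      (ne_top_of_le_ne_top ENNReal.ofReal_ne_top hlint)
    exact Measurable.aestronglyMeasurable (by fun_prop)
  refine ⟨hint, ?_⟩
  rwa [← ofReal_integral_eq_lintegral_ofReal hint (ae_of_all _ fun _ => by positivity),
    ENNReal.ofReal_le_ofReal_iff (by positivity)] at hlint

theorem sqNorm_nonneg {n : ℕ} (x : Fin n → ℝ) : 0 ≤ sqNorm x :=
  Finset.sum_nonneg fun _ _ => sq_nonneg _

theorem norm_toLp_sq {n : ℕ} (x : Fin n → ℝ) : ‖WithLp.toLp 2 x‖ ^ 2 = sqNorm x := by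
  simp [EuclideanSpace.norm_sq_eq, sqNorm]

theorem inner_toLp {n : ℕ} (x y : Fin n → ℝ) :
    inner ℝ (WithLp.toLp 2 x) (WithLp.toLp 2 y) = y ⬝ᵥ x := by
  simp [EuclideanSpace.inner_toLp_toLp]

/-- The law of an `m × n` matrix with independent standard Gaussian entries. -/
noncomputable def gaussianMatrix (m n : ℕ) : Measure (Matrix (Fin m) (Fin n) ℝ) :=
  (Measure.pi fun _ : Fin m => Measure.pi fun _ : Fin n => gaussianReal 0 1 :
    Measure (Fin m → Fin n → ℝ))

instance isProbabilityMeasure_gaussianMatrix (m n : ℕ) :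
    IsProbabilityMeasure (gaussianMatrix m n) :=
  inferInstanceAs (IsProbabilityMeasure
    (Measure.pi fun _ : Fin m => Measure.pi fun _ : Fin n => gaussianReal 0 1))

theorem integral_exp_dotProduct_sq_sub_le {n : ℕ} {z d : Fin n → ℝ} (hz : sqNorm z ≤ 4)
    (hzd : 4 * |z ⬝ᵥ d| ≤ sqNorm d) :
    Integrable (fun g => Real.exp ((1 / 32) * ((g ⬝ᵥ z) ^ 2 - (g ⬝ᵥ (z + d)) ^ 2)))
        (Measure.pi fun _ : Fin n => gaussianReal 0 1) ∧
      ∫ g, Real.exp ((1 / 32) * ((g ⬝ᵥ z) ^ 2 - (g ⬝ᵥ (z + d)) ^ 2))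
        ∂(Measure.pi fun _ : Fin n => gaussianReal 0 1) ≤ (√(1 + sqNorm d / 64))⁻¹ := by
  have h := integral_exp_inner_sq_sub_le (z := WithLp.toLp 2 z) (d := WithLp.toLp 2 d)
    (by rwa [norm_toLp_sq]) (by rwa [norm_toLp_sq, inner_toLp, dotProduct_comm])
  rw [← map_pi_eq_stdGaussian, norm_toLp_sq] at h
  have hm : Measurable (WithLp.toLp 2 : (Fin n → ℝ) → EuclideanSpace ℝ (Fin n)) := by fun_prop
  rw [integrable_map_measure (Measurable.aestronglyMeasurable (by fun_prop)) hm.aemeasurable,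
    integral_map hm.aemeasurable (Measurable.aestronglyMeasurable (by fun_prop))] at h
  simpa only [Function.comp_def, ← WithLp.toLp_add, inner_toLp] using h

theorem gaussianMatrix_sqNorm_mulVec_le {m n : ℕ} {z d : Fin n → ℝ} (hz : sqNorm z ≤ 4)
    (hzd : 4 * |z ⬝ᵥ d| ≤ sqNorm d) :
    gaussianMatrix m n {Φ | sqNorm (Φ.mulVec (z + d)) ≤ sqNorm (Φ.mulVec z)} ≤
      ENNReal.ofReal ((√(1 + sqNorm d / 64))⁻¹ ^ m) := by
  have h := integral_exp_dotProduct_sq_sub_le hz hzd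
  have h2 := pi_measure_sum_nonneg_le (ι := Fin m) 0 (fun _ => h.1) (fun _ => h.2)
  simp only [neg_zero, Real.exp_zero, one_mul, Finset.prod_const, Finset.card_univ,
    Fintype.card_fin] at h2
  refine le_trans (measure_mono ?_) h2
  intro Φ hΦ
  change ∑ i, (Φ i ⬝ᵥ (z + d)) ^ 2 ≤ ∑ i, (Φ i ⬝ᵥ z) ^ 2 at hΦ
  change 0 ≤ ∑ i, 1 / 32 * ((Φ i ⬝ᵥ z) ^ 2 - (Φ i ⬝ᵥ (z + d)) ^ 2)
  rw [← Finset.mul_sum, Finset.sum_sub_distrib]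
  exact mul_nonneg (by norm_num) (sub_nonneg.2 hΦ)

/-! ### Tails of the noise energy, and the number of candidates. -/

instance isProbabilityMeasure_noiseLaw (n : ℕ) : IsProbabilityMeasure (noiseLaw n) := by
  unfold noiseLaw
  infer_instance

/-- Exponential moment bound for the part of the noise energy carried by the set `T`. -/
theorem noiseLaw_mul_sum_sq_ge_le {n : ℕ} (hn : n ≠ 0) (T : Finset (Fin n)) {c : ℝ}
    (hc : 2 * c < 1) (a : ℝ) :
    noiseLaw n {z | a ≤ c * n * ∑ i ∈ T, z i ^ 2} ≤
      ENNReal.ofReal (Real.exp (-a) * (√(1 - 2 * c))⁻¹ ^ T.card) := by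
  have hn' : (n : ℝ) ≠ 0 := by exact_mod_cast hn
  have h1 := integral_exp_mul_sq_gaussianReal ((n : NNReal)⁻¹) (c := c * n) (by
    push_cast
    field_simp
    exact hc)
  have hcn : 1 - 2 * (c * n) * (((n : NNReal)⁻¹ : NNReal) : ℝ) = 1 - 2 * c := by
    push_cast
    field_simp
  rw [hcn] at h1
  have h := pi_measure_sum_nonneg_le (ι := Fin n) (μ := gaussianReal 0 ((n : NNReal)⁻¹))
    (f := fun i x => if i ∈ T then c * n * x ^ 2 else 0)
    (ρ := fun i => if i ∈ T then (√(1 - 2 * c))⁻¹ else 1) a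
    (fun i => by
      by_cases hi : i ∈ T
      · simpa [hi] using h1.1
      · simp [hi])
    (fun i => by
      by_cases hi : i ∈ T
      · simpa [hi] using h1.2.le
      · simp [hi])
  simpa [noiseLaw, Finset.sum_ite_mem, Finset.prod_ite_mem, ← Finset.mul_sum] using h

theorem noiseLaw_sum_sq_ge_le {n : ℕ} (hn : n ≠ 0) (T : Finset (Fin n)) (s : ℝ) :
    noiseLaw n {z | s ≤ ∑ i ∈ T, z i ^ 2} ≤
      ENNReal.ofReal (Real.exp (-(n * s / 4)) * √2 ^ T.card) := by
  have h := noiseLaw_mul_sum_sq_ge_le hn T (c := 1 / 4) (by norm_num) (n * s / 4)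
  have h2 : (√(1 - 2 * (1 / 4 : ℝ)))⁻¹ = √2 := by
    rw [← Real.sqrt_inv]
    norm_num
  rw [h2] at h
  have hn' : (0 : ℝ) < n := by positivity
  refine (measure_mono fun z hz => ?_).trans h
  simp only [Set.mem_ofPred_eq] at hz ⊢
  nlinarith

theorem noiseLaw_sum_sq_le_le {n : ℕ} (hn : n ≠ 0) (T : Finset (Fin n)) :
    noiseLaw n {z | ∑ i ∈ T, z i ^ 2 ≤ T.card / (2 * n)} ≤
      ENNReal.ofReal (Real.exp (-(T.card / 12))) := by
  have hn' : (0 : ℝ) < n := by positivity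
  -- A negative `c` gives the lower tail. Each coordinate contributes `e^{1/4}/√2`, which is below
  -- `e^{-1/12}`.
  have h := noiseLaw_mul_sum_sq_ge_le hn T (c := -(1 / 2)) (by norm_num) (-(T.card / 4))
  refine (measure_mono fun z hz => ?_).trans (h.trans (ENNReal.ofReal_le_ofReal ?_))
  · simp only [Set.mem_ofPred_eq] at hz ⊢
    rw [le_div_iff₀ (by positivity)] at hz
    linarith
  · have h2 : (√(1 - 2 * (-(1 / 2) : ℝ)))⁻¹ = Real.exp (-(Real.log 2 / 2)) := by
      rw [Real.exp_neg, Real.exp_half, Real.exp_log (by norm_num)]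
      norm_num
    rw [h2, ← Real.exp_nat_mul, ← Real.exp_add]
    apply Real.exp_le_exp.2
    have := Real.log_two_gt_d9
    nlinarith [Nat.cast_nonneg (α := ℝ) T.card]

theorem choose_mul_two_pow_le {n k : ℕ} (hk : 1 ≤ k) (hkn : k ≤ n) :
    (n.choose k : ℝ) * 2 ^ k ≤ Real.exp (k * (Real.log (n / k) + 2)) := by
  have hk' : (0 : ℝ) < k := by exact_mod_cast hk
  have hn' : (0 : ℝ) < n := by exact_mod_cast hk.trans hkn
  have h1 : (n.choose k : ℝ) ≤ n ^ k / k.factorial := Nat.choose_le_pow_div k n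
  have h2 : (n : ℝ) ^ k / k.factorial ≤ (n / k) ^ k * Real.exp k := by
    have := Real.pow_div_factorial_le_exp (k : ℝ) hk'.le k
    calc (n : ℝ) ^ k / k.factorial = (n / k) ^ k * (k ^ k / k.factorial) := by
          rw [div_pow]
          field_simp
      _ ≤ _ := by gcongr
  have h3 : (2 : ℝ) ^ k ≤ Real.exp k := by
    rw [← mul_one (k : ℝ), Real.exp_nat_mul]
    gcongr
    linarith [Real.exp_one_gt_d9]
  calc (n.choose k : ℝ) * 2 ^ k ≤ ((n / k) ^ k * Real.exp k) * Real.exp k := by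
        gcongr
        exact h1.trans h2
    _ = _ := by
        rw [mul_add, Real.exp_add, Real.exp_nat_mul, Real.exp_log (by positivity), mul_assoc,
          ← Real.exp_add]
        ring_nf

/-! ### A measurable decoder, and reduction to a fixed sparse part. -/

/-- Choosing a minimizer of a measurable cost among finitely many candidates is measurable. -/
theorem exists_measurable_argmin {Ω E : Type*} [MeasurableSpace Ω] [MeasurableSpace E]
    {c : Ω → E → ℝ} (hc : Measurable (Function.uncurry c)) {Y : Finset E} (hY : Y.Nonempty) :
    ∃ R : Ω → E, Measurable R ∧ (∀ ω, R ω ∈ Y) ∧ ∀ ω, ∀ y ∈ Y, c ω (R ω) ≤ c ω y := by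
  classical
  induction hY using Finset.Nonempty.cons_induction with
  | singleton a => exact ⟨fun _ => a, measurable_const, by simp, by simp⟩
  | cons a s ha hs ih =>
    obtain ⟨R, hR, hmem, hmin⟩ := ih
    refine ⟨fun ω => if c ω a ≤ c ω (R ω) then a else R ω, ?_, ?_, ?_⟩
    · refine Measurable.ite (measurableSet_le ?_ ?_) measurable_const hR
      · exact hc.comp (measurable_id.prodMk measurable_const)
      · exact hc.comp (measurable_id.prodMk hR)
    · intro ω
      dsimp only
      split_ifs
      · exact Finset.mem_cons_self a s
      · exact Finset.mem_cons_of_mem (hmem ω)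
    · intro ω y hy
      dsimp only
      rcases Finset.mem_cons.1 hy with rfl | hy
      · split_ifs with h
        · exact le_rfl
        · exact (not_le.1 h).le
      · split_ifs with h
        · exact h.trans (hmin ω y hy)
        · exact hmin ω y hy

/-- The shift is written as a measurable equivalence so that the pushforward can be evaluated on
arbitrary sets; measurability of the success event is then never needed. -/
theorem prod_spikedLaw {α : Type*} [MeasurableSpace α] (μ : Measure α) [IsProbabilityMeasure μ]
    {n k : ℕ} (hk : k ≤ n) (ε : ℝ) :
    μ.prod (spikedLaw n k ε) = ((n.choose k : ENNReal) * 2 ^ n)⁻¹ •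
      ∑ S ∈ Finset.powersetCard k (Finset.univ : Finset (Fin n)), ∑ σ : Fin n → Bool,
        (μ.prod (noiseLaw n)).map
          (MeasurableEquiv.prodCongr (MeasurableEquiv.refl α)
            (MeasurableEquiv.addLeft (spikeVector k ε S σ))) := by
  have := isProbabilityMeasure_spikedLaw hk ε
  ext s hs
  have hms (v : Fin n → ℝ) (a : α) :
      (noiseLaw n).map (fun z => v + z) (Prod.mk a ⁻¹' s) =
        noiseLaw n ((fun z => v + z) ⁻¹' (Prod.mk a ⁻¹' s)) :=
    Measure.map_apply (by fun_prop) (measurable_prodMk_left hs)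
  have hmeas (v : Fin n → ℝ) :
      Measurable fun a => noiseLaw n ((fun z => v + z) ⁻¹' (Prod.mk a ⁻¹' s)) :=
    measurable_measure_prodMk_left
      (s := (fun p : α × (Fin n → ℝ) => (p.1, v + p.2)) ⁻¹' s)
      (hs.preimage (by fun_prop))
  rw [Measure.prod_apply hs]
  simp only [spikedLaw, Measure.smul_apply, Measure.finsetSum_apply, smul_eq_mul, hms]
  rw [lintegral_const_mul _ (Finset.measurable_fun_sum _ fun S _ =>
    Finset.measurable_fun_sum _ fun σ _ => hmeas _),
    lintegral_finsetSum _ fun S _ => Finset.measurable_fun_sum _ fun σ _ => hmeas _]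
  congr 1
  refine Finset.sum_congr rfl fun S _ => ?_
  rw [lintegral_finsetSum _ fun σ _ => hmeas _]
  refine Finset.sum_congr rfl fun σ _ => ?_
  rw [MeasurableEquiv.map_apply, Measure.prod_apply (MeasurableEquiv.measurable _ hs)]
  rfl

/-- It suffices to bound the failure probability for each fixed sparse part of the signal. -/
theorem RecoverySystem.SolvesSpiked.of_forall_spikeVector {n m k : ℕ} {ε δ : ℝ}
    (A : RecoverySystem n m) (hk : k ≤ n) (hδ : 0 ≤ δ)
    (h : ∀ S : Finset (Fin n), S.card = k → ∀ σ : Fin n → Bool,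
      (A.dist.prod (noiseLaw n)) {p | ¬ A.Succeeds k ε (p.1, spikeVector k ε S σ + p.2)} ≤
        ENNReal.ofReal δ) :
    A.SolvesSpiked k ε δ := by
  have := A.isProbabilityMeasure_dist
  have := isProbabilityMeasure_spikedLaw hk ε
  set μ := A.dist.prod (spikedLaw n k ε) with hμ
  have hfail : μ {p | A.Succeeds k ε p}ᶜ ≤ ENNReal.ofReal δ := by
    rw [hμ, prod_spikedLaw _ hk]
    simp only [Measure.smul_apply, Measure.finsetSum_apply, smul_eq_mul,
      MeasurableEquiv.map_apply]
    have h0 : ((n.choose k : ENNReal) * 2 ^ n) ≠ 0 := by simp [Nat.choose_eq_zero_iff, hk]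
    have h1 : ((n.choose k : ENNReal) * 2 ^ n) ≠ ⊤ := ENNReal.mul_ne_top (by simp) (by simp)
    refine (mul_le_mul_right (Finset.sum_le_sum fun S hS => Finset.sum_le_sum fun σ _ =>
      h S (Finset.mem_powersetCard.1 hS).2 σ) _).trans (le_of_eq ?_)
    simp only [Finset.sum_const, Finset.card_univ, Finset.card_powersetCard, nsmul_eq_mul,
      Fintype.card_fin, Fintype.card_pi, Fintype.card_bool, Finset.prod_const]
    rw [← mul_assoc, Nat.cast_pow, Nat.cast_ofNat, ← mul_assoc, mul_assoc _ _ (2 ^ n),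
      ENNReal.inv_mul_cancel h0 h1, one_mul]
  have h1 : 1 ≤ μ {p | A.Succeeds k ε p} + ENNReal.ofReal δ := by
    calc (1 : ENNReal) = μ Set.univ := measure_univ.symm
      _ ≤ μ {p | A.Succeeds k ε p} + μ {p | A.Succeeds k ε p}ᶜ := by
          rw [← Set.union_compl_self {p | A.Succeeds k ε p}]
          exact measure_union_le _ _
      _ ≤ _ := by gcongr
  rw [RecoverySystem.SolvesSpiked, ENNReal.ofReal_sub _ hδ, ENNReal.ofReal_one]
  exact tsub_le_iff_right.2 h1

/-! ### Deterministic estimates for sparse vectors. -/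

theorem sum_spikeVector_sq_le {n k : ℕ} {ε : ℝ} (hε : 0 ≤ ε) (hk : 1 ≤ k) {S : Finset (Fin n)}
    (hS : S.card = k) (σ : Fin n → Bool) (H : Finset (Fin n)) :
    ∑ i ∈ H, spikeVector k ε S σ i ^ 2 ≤ ε := by
  have hk' : (0 : ℝ) < k := by exact_mod_cast hk
  have h (i : Fin n) : spikeVector k ε S σ i ^ 2 = if i ∈ S then ε / k else 0 := by
    have hs : √(ε / k) ^ 2 = ε / k := Real.sq_sqrt (by positivity)
    unfold spikeVector
    split_ifs
    · exact hs
    · rw [neg_sq, hs]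
    · simp
  calc ∑ i ∈ H, spikeVector k ε S σ i ^ 2 ≤ ∑ i, spikeVector k ε S σ i ^ 2 :=
        Finset.sum_le_sum_of_subset_of_nonneg (Finset.subset_univ _) fun _ _ _ => sq_nonneg _
    _ = ε := by
        simp only [h, Finset.sum_ite_mem, Finset.univ_inter, Finset.sum_const, hS, nsmul_eq_mul]
        field_simp

open Classical in
/-- All the possible sparse parts of a signal. -/
noncomputable def spikeVectors (n k : ℕ) (ε : ℝ) : Finset (Fin n → ℝ) :=
  (Finset.powersetCard k Finset.univ).biUnion fun S =>
    S.powerset.image fun P => spikeVector k ε S fun i => decide (i ∈ P)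

theorem mem_spikeVectors {n k : ℕ} {ε : ℝ} {y : Fin n → ℝ} :
    y ∈ spikeVectors n k ε ↔ ∃ S : Finset (Fin n), S.card = k ∧ ∃ σ, y = spikeVector k ε S σ := by
  classical
  simp only [spikeVectors, Finset.mem_biUnion, Finset.mem_powersetCard, Finset.subset_univ,
    true_and, Finset.mem_image, Finset.mem_powerset]
  constructor
  · rintro ⟨S, hS, P, -, rfl⟩
    exact ⟨S, hS, _, rfl⟩
  · rintro ⟨S, hS, σ, rfl⟩
    refine ⟨S, hS, S.filter fun i => σ i, Finset.filter_subset _ _, ?_⟩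
    ext i
    by_cases hi : i ∈ S <;> simp [spikeVector, hi]

/-- Signs off the support have no effect, so the sign factor is `2 ^ k` and not `2 ^ n`. -/
theorem card_spikeVectors_le (n k : ℕ) (ε : ℝ) :
    (spikeVectors n k ε).card ≤ n.choose k * 2 ^ k := by
  classical
  have h := Finset.card_biUnion_le_card_mul (Finset.powersetCard k (Finset.univ : Finset (Fin n)))
    (fun S => S.powerset.image fun P => spikeVector k ε S fun i => decide (i ∈ P)) (2 ^ k)
    fun S hS => Finset.card_image_le.trans (by
      rw [Finset.card_powerset, (Finset.mem_powersetCard.1 hS).2])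
  rwa [Finset.card_powersetCard, Finset.card_univ, Fintype.card_fin] at h

theorem sqNorm_add {n : ℕ} (x y : Fin n → ℝ) :
    sqNorm (x + y) = sqNorm x + 2 * (x ⬝ᵥ y) + sqNorm y := by
  simp only [sqNorm, dotProduct, Pi.add_apply, Finset.mul_sum, ← Finset.sum_add_distrib]
  exact Finset.sum_congr rfl fun i _ => by ring

theorem spikeVector_eq_zero {n k : ℕ} {ε : ℝ} {S : Finset (Fin n)} {σ : Fin n → Bool} {i : Fin n}
    (hi : i ∉ S) : spikeVector k ε S σ i = 0 := by
  simp [spikeVector, hi]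

/-- Off `S ∪ H` the vector on the right coincides with `z`. -/
theorem sqNorm_sub_le_sqNorm_zeroOn {n : ℕ} {y z : Fin n → ℝ} {S H : Finset (Fin n)}
    (hy : ∀ i ∉ S, y i = 0) :
    sqNorm z - ∑ i ∈ S, z i ^ 2 - ∑ i ∈ H, z i ^ 2 ≤ sqNorm (zeroOn H (y + z)) := by
  simp only [sqNorm, ← Finset.sum_ite_mem_eq S, ← Finset.sum_ite_mem_eq H,
    ← Finset.sum_sub_distrib]
  refine Finset.sum_le_sum fun i _ => ?_
  by_cases hS : i ∈ S <;> by_cases hH : i ∈ H <;> simp [zeroOn, hS, hH, hy, sq_nonneg]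

/-- Cauchy–Schwarz on `S ∪ T`: only the noise on the two supports is seen by `d`. -/
theorem dotProduct_sq_le {n : ℕ} {z d : Fin n → ℝ} {S T : Finset (Fin n)}
    (hd : ∀ i, i ∉ S → i ∉ T → d i = 0) {a : ℝ} (hS : ∑ i ∈ S, z i ^ 2 ≤ a)
    (hT : ∑ i ∈ T, z i ^ 2 ≤ a) : (z ⬝ᵥ d) ^ 2 ≤ 2 * a * sqNorm d := by
  have h1 : z ⬝ᵥ d = ∑ i ∈ S ∪ T, z i * d i := by
    refine (Finset.sum_subset (Finset.subset_univ _) fun i _ hi => ?_).symm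
    rw [Finset.mem_union, not_or] at hi
    rw [hd i hi.1 hi.2, mul_zero]
  have h2 : ∑ i ∈ S ∪ T, z i ^ 2 ≤ 2 * a := by
    have := Finset.sum_union_inter (s₁ := S) (s₂ := T) (f := fun i => z i ^ 2)
    have : 0 ≤ ∑ i ∈ S ∩ T, z i ^ 2 := Finset.sum_nonneg fun _ _ => sq_nonneg _
    linarith
  have h3 : ∑ i ∈ S ∪ T, d i ^ 2 ≤ sqNorm d :=
    Finset.sum_le_sum_of_subset_of_nonneg (Finset.subset_univ _) fun _ _ _ => sq_nonneg _
  rw [h1]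
  refine (Finset.sum_mul_sq_le_sq_mul_sq _ _ _).trans ?_
  exact mul_le_mul h2 h3 (Finset.sum_nonneg fun _ _ => sq_nonneg _)
    ((Finset.sum_nonneg fun _ _ => sq_nonneg _).trans h2)

/-- An estimate of the sparse part that is close enough satisfies the `ℓ₂/ℓ₂` guarantee. -/
theorem sqNorm_sub_le_of_close {n : ℕ} {ε : ℝ} (hε : 0 < ε) (hε1 : ε ≤ 1)
    {y y' z : Fin n → ℝ} {S S' H : Finset (Fin n)} (hy : ∀ i ∉ S, y i = 0)
    (hy' : ∀ i ∉ S', y' i = 0) (hz : 1 / 2 ≤ sqNorm z) (hS : ∑ i ∈ S, z i ^ 2 ≤ ε / 256)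
    (hS' : ∑ i ∈ S', z i ^ 2 ≤ ε / 256) (hH : ∑ i ∈ H, z i ^ 2 ≤ ε / 256)
    (hclose : sqNorm (y - y') ≤ ε / 8) :
    sqNorm (y' - (y + z)) ≤ (1 + ε) * sqNorm (zeroOn H (y + z)) := by
  have h1 : sqNorm (y' - (y + z)) = sqNorm z + 2 * (z ⬝ᵥ (y - y')) + sqNorm (y - y') := by
    rw [← sqNorm_add]
    exact Finset.sum_congr rfl fun i _ => by simp only [Pi.add_apply, Pi.sub_apply]; ring
  have h2 := dotProduct_sq_le (z := z) (d := y - y') (S := S) (T := S') (fun i h h' => by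
    rw [Pi.sub_apply, hy i h, hy' i h', sub_zero]) hS hS'
  have h3 : z ⬝ᵥ (y - y') ≤ ε / 32 := by
    refine le_of_sq_le_sq ?_ (by positivity)
    nlinarith
  have h4 := sqNorm_sub_le_sqNorm_zeroOn (z := z) (H := H) hy
  -- The error exceeds `‖z‖²` by at most `ε/16 + ε/8`, while the right side exceeds it by at least
  -- `ε/2 - ε/64`.
  nlinarith

theorem inv_sqrt_one_add_le {t : ℝ} (h0 : 0 ≤ t) (h1 : t ≤ 1) :
    (√(1 + t))⁻¹ ≤ Real.exp (-(t / 4)) := by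
  rw [Real.exp_neg]
  apply inv_anti₀ (Real.exp_pos _)
  apply Real.le_sqrt_of_sq_le
  rw [← Real.exp_nat_mul]
  have h := Real.one_sub_le_exp_neg (t / 2)
  rw [Real.exp_neg] at h
  have h2 : Real.exp (t / 2) * (1 - t / 2) ≤ 1 := by
    have := mul_le_mul_of_nonneg_left h (Real.exp_pos (t / 2)).le
    rwa [mul_inv_cancel₀ (Real.exp_pos _).ne'] at this
  have h3 : (1 : ℝ) ≤ (1 + t) * (1 - t / 2) := by nlinarith
  have h4 : Real.exp (t / 2) ≤ 1 + t := by
    have : 0 < 1 - t / 2 := by linarith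
    exact le_of_mul_le_mul_right (h2.trans h3) this
  convert! h4 using 2
  push_cast
  ring

/-! ### Probabilities of the bad events. -/

theorem prod_noiseLaw_snd {α : Type*} [MeasurableSpace α] (μ : Measure α) [IsProbabilityMeasure μ]
    {n : ℕ} (B : Set (Fin n → ℝ)) : (μ.prod (noiseLaw n)) {p | p.2 ∈ B} = noiseLaw n B := by
  have : {p : α × (Fin n → ℝ) | p.2 ∈ B} = Set.univ ×ˢ B := by
    ext
    simp
  rw [this, Measure.prod_prod, measure_univ, one_mul]

theorem noiseLaw_exists_sum_sq_ge_le {n k : ℕ} (hk : 1 ≤ k) (hkn : k ≤ n) (s : ℝ) :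
    noiseLaw n {z | ∃ H : Finset (Fin n), H.card = k ∧ s ≤ ∑ i ∈ H, z i ^ 2} ≤
      ENNReal.ofReal (Real.exp (k * (Real.log (n / k) + 2) - n * s / 4)) := by
  have hset : {z : Fin n → ℝ | ∃ H : Finset (Fin n), H.card = k ∧ s ≤ ∑ i ∈ H, z i ^ 2} ⊆
      ⋃ H ∈ Finset.powersetCard k (Finset.univ : Finset (Fin n)),
        {z | s ≤ ∑ i ∈ H, z i ^ 2} := by
    rintro z ⟨H, hH, h⟩
    simp only [Set.mem_iUnion]
    exact ⟨H, by simp [hH], h⟩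
  refine (measure_mono hset).trans ((measure_biUnion_finset_le _ _).trans ?_)
  refine (Finset.sum_le_sum fun H hH => noiseLaw_sum_sq_ge_le (by omega) H s).trans ?_
  rw [← ENNReal.ofReal_sum_of_nonneg fun _ _ => by positivity]
  apply ENNReal.ofReal_le_ofReal
  rw [Finset.sum_congr rfl fun H hH => by rw [(Finset.mem_powersetCard.1 hH).2],
    Finset.sum_const, Finset.card_powersetCard, Finset.card_univ, Fintype.card_fin, nsmul_eq_mul,
    sub_eq_add_neg, Real.exp_add]
  have h := choose_mul_two_pow_le hk hkn
  have h2 : √2 ^ k ≤ (2 : ℝ) ^ k := by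
    gcongr
    rw [Real.sqrt_le_left (by norm_num)]
    norm_num
  calc (n.choose k : ℝ) * (Real.exp (-(n * s / 4)) * √2 ^ k) ≤
      n.choose k * (Real.exp (-(n * s / 4)) * 2 ^ k) := by gcongr
    _ = (n.choose k * 2 ^ k) * Real.exp (-(n * s / 4)) := by ring
    _ ≤ _ := by gcongr

theorem noiseLaw_sqNorm_le_half_le {n : ℕ} (hn : n ≠ 0) :
    noiseLaw n {z | sqNorm z ≤ 1 / 2} ≤ ENNReal.ofReal (Real.exp (-(n / 12))) := by
  have h := noiseLaw_sum_sq_le_le hn Finset.univ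
  have hn' : (n : ℝ) ≠ 0 := by exact_mod_cast hn
  rw [Finset.card_univ, Fintype.card_fin,
    show (n : ℝ) / (2 * n) = 1 / 2 by field_simp] at h
  exact h

theorem noiseLaw_four_le_sqNorm_le {n : ℕ} (hn : n ≠ 0) :
    noiseLaw n {z | 4 ≤ sqNorm z} ≤ ENNReal.ofReal (Real.exp (-(n / 12))) := by
  have h := noiseLaw_sum_sq_ge_le hn Finset.univ 4
  refine h.trans (ENNReal.ofReal_le_ofReal ?_)
  have h2 : √2 = Real.exp (Real.log 2 / 2) := by
    rw [Real.exp_half, Real.exp_log (by norm_num)]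
  rw [Finset.card_univ, Fintype.card_fin, h2, ← Real.exp_nat_mul, ← Real.exp_add]
  apply Real.exp_le_exp.2
  nlinarith [Real.log_two_lt_d9, Nat.cast_nonneg (α := ℝ) n]

theorem measurable_sqNorm {n : ℕ} : Measurable (sqNorm : (Fin n → ℝ) → ℝ) := by
  unfold sqNorm
  fun_prop

theorem measurable_mulVec (m n : ℕ) :
    Measurable fun p : Matrix (Fin m) (Fin n) ℝ × (Fin n → ℝ) => p.1.mulVec p.2 := by
  have hent (i : Fin m) (j : Fin n) : Measurable fun Φ : Matrix (Fin m) (Fin n) ℝ => Φ i j :=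
    (measurable_pi_apply j).comp (measurable_pi_apply (X := fun _ : Fin m => Fin n → ℝ) i)
  refine measurable_pi_lambda _ fun i => ?_
  simp only [Matrix.mulVec, dotProduct]
  refine Finset.measurable_fun_sum _ fun j _ => ?_
  exact ((hent i j).comp measurable_fst).mul ((measurable_pi_apply j).comp measurable_snd)

/-- By Fubini the noise can be frozen: either it violates the first two conditions and the slice is
empty, or the bound for a fixed `z` applies. -/
theorem gaussianMatrix_prod_noiseLaw_le {m n : ℕ} (d : Fin n → ℝ) :
    ((gaussianMatrix m n).prod (noiseLaw n)) {p | sqNorm p.2 ≤ 4 ∧ 4 * |p.2 ⬝ᵥ d| ≤ sqNorm d ∧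
        sqNorm (p.1.mulVec (p.2 + d)) ≤ sqNorm (p.1.mulVec p.2)} ≤
      ENNReal.ofReal ((√(1 + sqNorm d / 64))⁻¹ ^ m) := by
  have hdot : Measurable fun p : Matrix (Fin m) (Fin n) ℝ × (Fin n → ℝ) => 4 * |p.2 ⬝ᵥ d| := by
    simp only [dotProduct]
    fun_prop
  have hmul := measurable_mulVec m n
  have hmeas : MeasurableSet {p : Matrix (Fin m) (Fin n) ℝ × (Fin n → ℝ) |
      sqNorm p.2 ≤ 4 ∧ 4 * |p.2 ⬝ᵥ d| ≤ sqNorm d ∧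
        sqNorm (p.1.mulVec (p.2 + d)) ≤ sqNorm (p.1.mulVec p.2)} := by
    exact (measurableSet_le (measurable_sqNorm.comp measurable_snd) measurable_const).inter
      ((measurableSet_le hdot measurable_const).inter (measurableSet_le
        (measurable_sqNorm.comp (hmul.comp (measurable_fst.prodMk (by fun_prop :
          Measurable fun p : Matrix (Fin m) (Fin n) ℝ × (Fin n → ℝ) => p.2 + d))))
        (measurable_sqNorm.comp hmul)))
  rw [Measure.prod_apply_symm hmeas]
  refine (lintegral_mono (g := fun _ => ENNReal.ofReal ((√(1 + sqNorm d / 64))⁻¹ ^ m))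
    fun z => ?_).trans (by simp)
  by_cases hz : sqNorm z ≤ 4 ∧ 4 * |z ⬝ᵥ d| ≤ sqNorm d
  · exact (measure_mono fun Φ hΦ => hΦ.2.2).trans (gaussianMatrix_sqNorm_mulVec_le hz.1 hz.2)
  · refine (measure_mono_null (fun Φ hΦ => ?_) (measure_empty (μ := gaussianMatrix m n))).trans_le
      zero_le
    exact hz ⟨hΦ.1, hΦ.2.1⟩

theorem RecoverySystem.SolvesSpiked.mono {n m k : ℕ} {ε δ δ' : ℝ} {A : RecoverySystem n m}
    (h : A.SolvesSpiked k ε δ) (hδ : δ ≤ δ') : A.SolvesSpiked k ε δ' :=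
  (ENNReal.ofReal_le_ofReal (by linarith)).trans h

/-- The probability that some far away sparse vector fits the measurements as well as the true
sparse part. -/
theorem gaussianMatrix_prod_noiseLaw_exists_far_le {n k m : ℕ} {ε L : ℝ} (hk : 1 ≤ k)
    (hkn : k ≤ n) (hε : 0 < ε) (hε1 : ε ≤ 1) (hN : k * (Real.log (n / k) + 2) ≤ 4 * L)
    (hm : 10240 * L ≤ m * ε) (y : Fin n → ℝ) :
    ((gaussianMatrix m n).prod (noiseLaw n)) {p | ∃ y' ∈ spikeVectors n k ε,
        ε / 8 ≤ sqNorm (y - y') ∧ sqNorm p.2 ≤ 4 ∧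
        4 * |p.2 ⬝ᵥ (y - y')| ≤ sqNorm (y - y') ∧
        sqNorm (p.1.mulVec (p.2 + (y - y'))) ≤ sqNorm (p.1.mulVec p.2)} ≤
      ENNReal.ofReal (Real.exp (-L)) := by
  classical
  set Y := (spikeVectors n k ε).filter fun y' => ε / 8 ≤ sqNorm (y - y') with hY
  have hset : {p : Matrix (Fin m) (Fin n) ℝ × (Fin n → ℝ) | ∃ y' ∈ spikeVectors n k ε,
      ε / 8 ≤ sqNorm (y - y') ∧ sqNorm p.2 ≤ 4 ∧
      4 * |p.2 ⬝ᵥ (y - y')| ≤ sqNorm (y - y') ∧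
      sqNorm (p.1.mulVec (p.2 + (y - y'))) ≤ sqNorm (p.1.mulVec p.2)} ⊆
      ⋃ y' ∈ Y, {p | sqNorm p.2 ≤ 4 ∧ 4 * |p.2 ⬝ᵥ (y - y')| ≤ sqNorm (y - y') ∧
        sqNorm (p.1.mulVec (p.2 + (y - y'))) ≤ sqNorm (p.1.mulVec p.2)} := by
    rintro p ⟨y', hy', hfar, h⟩
    simp only [Set.mem_iUnion]
    exact ⟨y', Finset.mem_filter.2 ⟨hy', hfar⟩, h⟩
  have hbound (y' : Fin n → ℝ) (hy' : y' ∈ Y) :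
      -- Distance `ε/8` gives a factor `e^{-ε/2048}` per row, and `10240 = 5 · 2048`. The surplus
      -- over `4L` pays for the union bound.
      (√(1 + sqNorm (y - y') / 64))⁻¹ ^ m ≤ Real.exp (-(5 * L)) := by
    have h1 : (√(1 + sqNorm (y - y') / 64))⁻¹ ≤ Real.exp (-(ε / 512 / 4)) := by
      refine le_trans ?_ (inv_sqrt_one_add_le (t := ε / 512) (by positivity) (by linarith))
      have := (Finset.mem_filter.1 hy').2
      refine inv_anti₀ (by positivity) (Real.sqrt_le_sqrt ?_)
      linarith
    calc _ ≤ Real.exp (-(ε / 512 / 4)) ^ m := by gcongr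
      _ ≤ _ := by
        rw [← Real.exp_nat_mul]
        apply Real.exp_le_exp.2
        linarith
  refine (measure_mono hset).trans ((measure_biUnion_finset_le _ _).trans ?_)
  refine (Finset.sum_le_sum fun y' hy' => (gaussianMatrix_prod_noiseLaw_le _).trans
    (ENNReal.ofReal_le_ofReal (hbound y' hy'))).trans ?_
  rw [← ENNReal.ofReal_sum_of_nonneg fun _ _ => by positivity]
  apply ENNReal.ofReal_le_ofReal
  rw [Finset.sum_const, nsmul_eq_mul]
  have hcard : (Y.card : ℝ) ≤ Real.exp (4 * L) := by
    calc (Y.card : ℝ) ≤ (n.choose k * 2 ^ k : ℕ) := by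
          exact_mod_cast (Finset.card_filter_le _ _).trans (card_spikeVectors_le n k ε)
      _ ≤ Real.exp (k * (Real.log (n / k) + 2)) := by
          push_cast
          exact choose_mul_two_pow_le hk hkn
      _ ≤ _ := Real.exp_le_exp.2 hN
  calc (Y.card : ℝ) * Real.exp (-(5 * L)) ≤ Real.exp (4 * L) * Real.exp (-(5 * L)) := by gcongr
    _ = Real.exp (-L) := by
      rw [← Real.exp_add]
      ring_nf

/-- Gaussian measurements, decoded to the sparse vector that fits best. -/
theorem exists_solvesSpiked_of_gaussianMatrix {n k m : ℕ} {ε L : ℝ} (hk : 1 ≤ k) (hkn : k ≤ n)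
    (hε : 0 < ε) (hε1 : ε ≤ 1) (hN : k * (Real.log (n / k) + 2) ≤ 4 * L)
    (hn : 5120 * L ≤ ε * n) (hm : 10240 * L ≤ m * ε) :
    ∃ A : RecoverySystem n m, A.SolvesSpiked k ε (4 * Real.exp (-L)) := by
  have hn0 : n ≠ 0 := by omega
  have hmem (S : Finset (Fin n)) (hS : S.card = k) (σ : Fin n → Bool) :
      spikeVector k ε S σ ∈ spikeVectors n k ε := mem_spikeVectors.2 ⟨S, hS, σ, rfl⟩
  obtain ⟨S₀, -, hS₀⟩ := Finset.exists_subset_card_eq (s := (Finset.univ : Finset (Fin n)))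
    (n := k) (by simpa using hkn)
  obtain ⟨R, hR, hRmem, hRmin⟩ := exists_measurable_argmin
    (Ω := Matrix (Fin m) (Fin n) ℝ × (Fin m → ℝ)) (E := Fin n → ℝ)
    (c := fun ω y => sqNorm (ω.2 - ω.1.mulVec y))
    (measurable_sqNorm.comp ((measurable_snd.comp measurable_fst).sub
      ((measurable_mulVec m n).comp ((measurable_fst.comp measurable_fst).prodMk measurable_snd))))
    (Y := spikeVectors n k ε) ⟨_, hmem S₀ hS₀ fun _ => true⟩
  refine ⟨⟨gaussianMatrix m n, inferInstance, fun Φ v => R (Φ, v), hR⟩,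
    .of_forall_spikeVector _ hkn (by positivity) fun S hS σ => ?_⟩
  set y := spikeVector k ε S σ with hy
  set μ := (gaussianMatrix m n).prod (noiseLaw n)
  set Far : Set (Matrix (Fin m) (Fin n) ℝ × (Fin n → ℝ)) := {p | ∃ y' ∈ spikeVectors n k ε,
    ε / 8 ≤ sqNorm (y - y') ∧ sqNorm p.2 ≤ 4 ∧ 4 * |p.2 ⬝ᵥ (y - y')| ≤ sqNorm (y - y') ∧
    sqNorm (p.1.mulVec (p.2 + (y - y'))) ≤ sqNorm (p.1.mulVec p.2)}
  set Low : Set (Fin n → ℝ) := {z | sqNorm z ≤ 1 / 2}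
  set High : Set (Fin n → ℝ) := {z | 4 ≤ sqNorm z}
  set Top : Set (Fin n → ℝ) := {z | ∃ H : Finset (Fin n), H.card = k ∧
    ε / 256 ≤ ∑ i ∈ H, z i ^ 2}
  have hεn : ε * n ≤ n := mul_le_of_le_one_left (by positivity) hε1
  have hexp : Real.exp (-(n / 12)) ≤ Real.exp (-L) := Real.exp_le_exp.2 (by linarith)
  have hμFar : μ Far ≤ ENNReal.ofReal (Real.exp (-L)) :=
    gaussianMatrix_prod_noiseLaw_exists_far_le hk hkn hε hε1 hN hm y
  have hμLow : μ {p | p.2 ∈ Low} ≤ ENNReal.ofReal (Real.exp (-L)) := by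
    rw [prod_noiseLaw_snd]
    exact (noiseLaw_sqNorm_le_half_le hn0).trans (ENNReal.ofReal_le_ofReal hexp)
  have hμHigh : μ {p | p.2 ∈ High} ≤ ENNReal.ofReal (Real.exp (-L)) := by
    rw [prod_noiseLaw_snd]
    exact (noiseLaw_four_le_sqNorm_le hn0).trans (ENNReal.ofReal_le_ofReal hexp)
  have hμTop : μ {p | p.2 ∈ Top} ≤ ENNReal.ofReal (Real.exp (-L)) := by
    rw [prod_noiseLaw_snd]
    refine (noiseLaw_exists_sum_sq_ge_le hk hkn _).trans (ENNReal.ofReal_le_ofReal ?_)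
    -- `n · (ε/256) / 4 ≥ 5L` by `hn`, against a count of at most `e^{4L}`.
    exact Real.exp_le_exp.2 (by linarith)
  have hsub : {p : Matrix (Fin m) (Fin n) ℝ × (Fin n → ℝ) | ¬ RecoverySystem.Succeeds
      ⟨gaussianMatrix m n, inferInstance, fun Φ v => R (Φ, v), hR⟩ k ε (p.1, y + p.2)} ⊆
      (Far ∪ {p | p.2 ∈ Low}) ∪ ({p | p.2 ∈ High} ∪ {p | p.2 ∈ Top}) := by
    rintro ⟨Φ, z⟩ hfail
    by_contra hgood
    simp only [Set.mem_union, not_or] at hgood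
    obtain ⟨⟨hgFar, hgLow⟩, hgHigh, hgTop⟩ := hgood
    have hz1 : 1 / 2 ≤ sqNorm z := (not_le.1 hgLow).le
    have hz2 : sqNorm z ≤ 4 := (not_le.1 hgHigh).le
    have htop (H : Finset (Fin n)) (hH : H.card = k) : ∑ i ∈ H, z i ^ 2 ≤ ε / 256 := by
      by_contra h
      exact hgTop ⟨H, hH, (not_le.1 h).le⟩
    apply hfail
    intro H hH
    dsimp only at hH ⊢
    set y' := R (Φ, Φ.mulVec (y + z)) with hy'
    have hy'mem : y' ∈ spikeVectors n k ε := hRmem _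
    obtain ⟨S', hS', σ', hy'eq⟩ := mem_spikeVectors.1 hy'mem
    have hyz : ∀ i ∉ S, y i = 0 := fun i hi => spikeVector_eq_zero hi
    have hyz' : ∀ i ∉ S', y' i = 0 := fun i hi => by
      rw [hy'eq]
      exact spikeVector_eq_zero hi
    refine sqNorm_sub_le_of_close hε hε1 hyz hyz' hz1 (htop S hS) (htop S' hS')
      (htop H hH.1) ?_
    by_contra hfar
    rw [not_le] at hfar
    refine hgFar ⟨y', hy'mem, hfar.le, hz2, ?_, ?_⟩
    · have h2 := dotProduct_sq_le (z := z) (d := y - y') (S := S) (T := S') (fun i h h' => by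
        rw [Pi.sub_apply, hyz i h, hyz' i h', sub_zero]) (htop S hS) (htop S' hS')
      refine le_of_sq_le_sq ?_ (sqNorm_nonneg _)
      rw [mul_pow, sq_abs]
      -- With `ε/256` on each support, `16 (z ⬝ᵥ d)² ≤ (ε/8) ‖d‖²`, and `ε/8 < ‖d‖²` because the
      -- candidate is far.
      nlinarith
    · have h := hRmin (Φ, Φ.mulVec (y + z)) y (hmem S hS σ)
      dsimp only at h
      rw [← hy', ← Matrix.mulVec_sub, ← Matrix.mulVec_sub, add_sub_cancel_left] at h
      rwa [show z + (y - y') = y + z - y' by abel]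
  refine (measure_mono hsub).trans ?_
  refine (measure_union_le _ _).trans ((add_le_add (measure_union_le _ _)
    (measure_union_le _ _)).trans ((add_le_add (add_le_add hμFar hμLow)
      (add_le_add hμHigh hμTop)).trans (le_of_eq ?_)))
  rw [← ENNReal.ofReal_add, ← ENNReal.ofReal_add]
  · ring_nf
  all_goals positivity

/-! ### Sampling coordinates. -/

instance measurableSingletonClass_matrix (m n : ℕ) :
    MeasurableSingletonClass (Matrix (Fin m) (Fin n) ℝ) :=
  inferInstanceAs (MeasurableSingletonClass (Fin m → Fin n → ℝ))

theorem dirac_prod_noiseLaw_le {m n : ℕ} (Φ : Matrix (Fin m) (Fin n) ℝ)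
    (F : Set (Matrix (Fin m) (Fin n) ℝ × (Fin n → ℝ))) :
    ((Measure.dirac Φ).prod (noiseLaw n)) F ≤ noiseLaw n {z | (Φ, z) ∈ F} := by
  have hsub : F ⊆ ({Φ}ᶜ ×ˢ Set.univ) ∪ {p | p.2 ∈ {z | (Φ, z) ∈ F}} := by
    rintro ⟨Ψ, z⟩ h
    by_cases hΨ : Ψ = Φ
    · subst hΨ
      exact Or.inr h
    · exact Or.inl ⟨hΨ, trivial⟩
  refine (measure_mono hsub).trans ((measure_union_le _ _).trans ?_)
  rw [Measure.prod_prod, prod_noiseLaw_snd,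
    Measure.dirac_apply' _ (measurableSet_singleton Φ).compl]
  simp

/-- Observing the first `m` coordinates of the signal, and guessing `0` for the others. -/
noncomputable def coordinateSystem {n m : ℕ} (hmn : m ≤ n) : RecoverySystem n m where
  dist := Measure.dirac (Matrix.of fun i j => if Fin.castLE hmn i = j then 1 else 0)
  isProbabilityMeasure_dist := inferInstance
  recover _ v j := if h : (j : ℕ) < m then v ⟨j, h⟩ else 0
  measurable_recover := by
    refine measurable_pi_lambda _ fun j => ?_
    simp only [Function.uncurry_def]
    split_ifs with h
    · exact (measurable_pi_apply _).comp measurable_snd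
    · exact measurable_const

/-- The squared error is the energy of `x` outside the sampled set, hence at most the energy outside
`H`; the factor `1 + ε` is not even required. -/
theorem coordinateSystem_succeeds {n m k : ℕ} (hmn : m ≤ n) {ε : ℝ} (hε : 0 ≤ ε) {x : Fin n → ℝ}
    (h : ∀ H : Finset (Fin n), H.card = k →
      ∑ i ∈ H, x i ^ 2 ≤ ∑ i ∈ Finset.univ.map (Fin.castLEEmb hmn), x i ^ 2) :
    (coordinateSystem hmn).Succeeds k ε
      (Matrix.of fun i j => if Fin.castLE hmn i = j then 1 else 0, x) := by
  intro H hH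
  have h1 : sqNorm (zeroOn H x) = sqNorm x - ∑ i ∈ H, x i ^ 2 := by
    simp only [sqNorm, ← Finset.sum_ite_mem_eq H, ← Finset.sum_sub_distrib]
    refine Finset.sum_congr rfl fun i _ => ?_
    by_cases hi : i ∈ H <;> simp [zeroOn, hi]
  have h2 : sqNorm ((coordinateSystem hmn).recover
      (Matrix.of fun i j => if Fin.castLE hmn i = j then 1 else 0)
      ((Matrix.of fun i j => if Fin.castLE hmn i = j then 1 else 0 :
        Matrix (Fin m) (Fin n) ℝ).mulVec x) - x) =
      sqNorm x - ∑ i ∈ Finset.univ.map (Fin.castLEEmb hmn), x i ^ 2 := by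
    simp only [sqNorm, ← Finset.sum_ite_mem_eq (Finset.univ.map (Fin.castLEEmb hmn)),
      ← Finset.sum_sub_distrib]
    refine Finset.sum_congr rfl fun i _ => ?_
    by_cases hi : (i : ℕ) < m
    · have hmem : i ∈ Finset.univ.map (Fin.castLEEmb hmn) :=
        Finset.mem_map.2 ⟨⟨i, hi⟩, Finset.mem_univ _, rfl⟩
      simp [coordinateSystem, hi, hmem, Matrix.mulVec, dotProduct]
    · have hmem : i ∉ Finset.univ.map (Fin.castLEEmb hmn) := by
        rintro h
        obtain ⟨j, -, rfl⟩ := Finset.mem_map.1 h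
        exact hi j.2
      simp [coordinateSystem, hi, hmem]
  dsimp only
  rw [h2]
  have h3 := sqNorm_nonneg (zeroOn H x)
  have h4 := h H hH.1
  rw [h1] at h3 ⊢
  nlinarith

theorem coordinateSystem_solvesSpiked {n m k : ℕ} (hmn : m ≤ n) (hkn : k ≤ n) {ε δ : ℝ}
    (hε : 0 ≤ ε) (hδ : 0 ≤ δ)
    (h : ∀ S : Finset (Fin n), S.card = k → ∀ σ : Fin n → Bool,
      noiseLaw n {z | ∃ H : Finset (Fin n), H.card = k ∧
        ∑ i ∈ Finset.univ.map (Fin.castLEEmb hmn), (spikeVector k ε S σ + z) i ^ 2 <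
          ∑ i ∈ H, (spikeVector k ε S σ + z) i ^ 2} ≤ ENNReal.ofReal δ) :
    (coordinateSystem hmn).SolvesSpiked k ε δ := by
  refine .of_forall_spikeVector _ hkn hδ fun S hS σ => ?_
  refine (dirac_prod_noiseLaw_le _ _).trans (le_trans (measure_mono ?_) (h S hS σ))
  intro z hz
  by_contra hz'
  refine hz (coordinateSystem_succeeds hmn hε fun H hH => ?_)
  by_contra hlt
  exact hz' ⟨H, hH, not_le.1 hlt⟩

theorem coordinateSystem_self_solvesSpiked {n k : ℕ} (hkn : k ≤ n) {ε δ : ℝ}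
    (hε : 0 ≤ ε) (hδ : 0 ≤ δ) : (coordinateSystem (le_refl n)).SolvesSpiked k ε δ := by
  refine coordinateSystem_solvesSpiked le_rfl hkn hε hδ fun S _ σ => ?_
  refine (measure_mono_null ?_ (measure_empty (μ := noiseLaw n))).trans_le zero_le
  rintro z ⟨H, -, h⟩
  refine absurd h (not_lt.2 (Finset.sum_le_sum_of_subset_of_nonneg (fun i _ => ?_)
    fun _ _ _ => sq_nonneg _))
  exact Finset.mem_map.2 ⟨i, Finset.mem_univ _, rfl⟩

theorem sum_spikeVector_add_sq_le {n k : ℕ} {ε : ℝ} (hε : 0 ≤ ε) (hk : 1 ≤ k)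
    {S : Finset (Fin n)} (hS : S.card = k) (σ : Fin n → Bool) (z : Fin n → ℝ)
    (H : Finset (Fin n)) :
    ∑ i ∈ H, (spikeVector k ε S σ + z) i ^ 2 ≤ 2 * ε + 2 * ∑ i ∈ H, z i ^ 2 := by
  have h1 : ∑ i ∈ H, (spikeVector k ε S σ + z) i ^ 2 ≤
      2 * ∑ i ∈ H, spikeVector k ε S σ i ^ 2 + 2 * ∑ i ∈ H, z i ^ 2 := by
    rw [Finset.mul_sum, Finset.mul_sum, ← Finset.sum_add_distrib]
    refine Finset.sum_le_sum fun i _ => ?_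
    rw [Pi.add_apply]
    nlinarith [sq_nonneg (spikeVector k ε S σ i - z i)]
  linarith [sum_spikeVector_sq_le hε hk hS σ H]

theorem sum_sdiff_sq_le_sum_spikeVector_add_sq {n k : ℕ} {ε : ℝ} (S M : Finset (Fin n))
    (σ : Fin n → Bool) (z : Fin n → ℝ) :
    ∑ i ∈ M \ S, z i ^ 2 ≤ ∑ i ∈ M, (spikeVector k ε S σ + z) i ^ 2 := by
  refine le_trans (le_of_eq (Finset.sum_congr rfl fun i hi => ?_))
    (Finset.sum_le_sum_of_subset_of_nonneg Finset.sdiff_subset fun _ _ _ => sq_nonneg _)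
  rw [Pi.add_apply, spikeVector_eq_zero (Finset.mem_sdiff.1 hi).2, zero_add]

/-- At least `m/2` sampled coordinates avoid the support and carry pure noise of energy at least
`m/(4n)` with high probability. Any `k` coordinates of `x` carry at most `2ε` plus twice their noise
energy, which `hm` makes smaller. -/
theorem coordinateSystem_solvesSpiked_of_le {n m k : ℕ} (hmn : m ≤ n) (hk : 1 ≤ k)
    (hkm : 2 * k ≤ m) {ε L : ℝ} (hε : 0 ≤ ε)
    (hm : 8 * (ε * n) + 32 * (k * (Real.log (n / k) + 2) + L) ≤ m) (hmL : 24 * L ≤ m) :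
    (coordinateSystem hmn).SolvesSpiked k ε (2 * Real.exp (-L)) := by
  have hkn : k ≤ n := by omega
  have hn0 : n ≠ 0 := by omega
  have hn' : (0 : ℝ) < n := by positivity
  refine coordinateSystem_solvesSpiked hmn hkn hε (by positivity) fun S hS σ => ?_
  set N : ℝ := k * (Real.log (n / k) + 2) with hN
  set M : Finset (Fin n) := Finset.univ.map (Fin.castLEEmb hmn) with hM
  -- Chosen so that the union-bound exponent `N - n s / 4` equals `-L`.
  set s : ℝ := 4 * (N + L) / n with hs
  have hcard : (m : ℝ) / 2 ≤ (M \ S).card := by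
    have h1 := Finset.le_card_sdiff S M
    rw [hM, Finset.card_map, Finset.card_univ, Fintype.card_fin, ← hM, hS] at h1
    have h2 : m ≤ 2 * (M \ S).card := by omega
    have h3 : (m : ℝ) ≤ 2 * (M \ S).card := by exact_mod_cast h2
    linarith
  set Top : Set (Fin n → ℝ) := {z | ∃ H : Finset (Fin n), H.card = k ∧ s ≤ ∑ i ∈ H, z i ^ 2}
  set Low : Set (Fin n → ℝ) := {z | ∑ i ∈ M \ S, z i ^ 2 ≤ (M \ S).card / (2 * n)}
  have hTop : noiseLaw n Top ≤
      ENNReal.ofReal (Real.exp (-L)) := by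
    refine (noiseLaw_exists_sum_sq_ge_le hk hkn s).trans (ENNReal.ofReal_le_ofReal ?_)
    apply Real.exp_le_exp.2
    rw [← hN, hs]
    field_simp
    linarith
  have hLow : noiseLaw n Low ≤
      ENNReal.ofReal (Real.exp (-L)) := by
    refine (noiseLaw_sum_sq_le_le hn0 _).trans (ENNReal.ofReal_le_ofReal ?_)
    exact Real.exp_le_exp.2 (by linarith)
  have hsub : {z | ∃ H : Finset (Fin n), H.card = k ∧
      ∑ i ∈ M, (spikeVector k ε S σ + z) i ^ 2 < ∑ i ∈ H, (spikeVector k ε S σ + z) i ^ 2} ⊆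
      Top ∪ Low := by
    rintro z ⟨H, hH, hlt⟩
    by_contra hgood
    rw [Set.mem_union, not_or] at hgood
    have hH1 : ∑ i ∈ H, z i ^ 2 < s := by
      by_contra h
      exact hgood.1 ⟨H, hH, not_lt.1 h⟩
    have hM1 : (M \ S).card / (2 * n) < ∑ i ∈ M \ S, z i ^ 2 := not_le.1 hgood.2
    have hM2 := sum_sdiff_sq_le_sum_spikeVector_add_sq (k := k) (ε := ε) S M σ z
    have hH2 := sum_spikeVector_add_sq_le hε hk hS σ z H
    have hmid : 2 * ε + 2 * s ≤ (M \ S).card / (2 * n) := by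
      rw [hs, le_div_iff₀ (by positivity)]
      field_simp
      linarith
    linarith
  calc noiseLaw n _ ≤ noiseLaw n (Top ∪ Low) := measure_mono hsub
    _ ≤ noiseLaw n Top + noiseLaw n Low := measure_union_le _ _
    _ ≤ ENNReal.ofReal (Real.exp (-L)) + ENNReal.ofReal (Real.exp (-L)) := add_le_add hTop hLow
    _ = ENNReal.ofReal (2 * Real.exp (-L)) := by
      rw [← ENNReal.ofReal_add (by positivity) (by positivity)]
      ring_nf

/-! ### Choice of parameters and the three regimes. -/

theorem mainTheorem8 (β : ℝ) (hβ0 : 0 < β) (hβ1 : β < 1) :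
    ∃ C : ℝ, 0 < C ∧
      ∀ (n k : ℕ) (ε δ : ℝ), 1 ≤ k → 0 < ε → ε ≤ 1 → 0 < δ → δ < 1 →
        (k : ℝ) / ε ≤ β * n →
        (k : ℝ) / ε * Real.log (1 / δ) ≤ β * n →
        ∃ m : ℕ,
          (m : ℝ) ≤ C * ((k : ℝ) / ε * Real.log (ε * n / k) + 1 / ε * Real.log (1 / δ)) ∧
          ∃ A : RecoverySystem n m, A.SolvesSpiked k ε δ := by
  have hl0 : 0 < Real.log (1 / β) := Real.log_pos (by rw [lt_div_iff₀ hβ0]; linarith)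
  -- The first bound ensures `m ≤ n` and enough noise dimensions; the second forces `r ≥ 4` when `L
  -- < cεn`.
  set c : ℝ := min (1 / 10241) (Real.log (1 / β) / 4) with hc
  have hc0 : 0 < c := by positivity
  have hc1 : c ≤ 1 / 10241 := min_le_left _ _
  have hc2 : c ≤ Real.log (1 / β) / 4 := min_le_right _ _
  refine ⟨1 / c + 10241, by positivity, fun n k ε δ hk hε hε1 hδ hδ1 h1 _ => ?_⟩
  have hk1 : (1 : ℝ) ≤ k := by exact_mod_cast hk
  have hk0 : (0 : ℝ) < k := by linarith
  rw [div_le_iff₀ hε] at h1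
  have hn0 : (0 : ℝ) < n := by
    by_contra h
    have : (n : ℝ) = 0 := le_antisymm (not_lt.1 h) (Nat.cast_nonneg n)
    rw [this] at h1
    linarith
  have hkn : k ≤ n := by
    have : (k : ℝ) ≤ n := by
      calc (k : ℝ) ≤ β * n * ε := h1
        _ ≤ 1 * n * 1 := by gcongr
        _ = n := by ring
    exact_mod_cast this
  set r : ℝ := ε * n / k with hr
  have hr0 : 0 < r := by positivity
  have hkr : k * r = ε * n := by rw [hr]; field_simp
  have hβr : 1 / β ≤ r := by
    rw [hr, div_le_div_iff₀ hβ0 hk0]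
    linarith
  have hlr : Real.log (1 / β) ≤ Real.log r := Real.log_le_log (by positivity) hβr
  have hD : 0 < Real.log (1 / δ) := Real.log_pos (by rw [lt_div_iff₀ hδ]; linarith)
  set L : ℝ := k * Real.log r + Real.log (1 / δ) with hL
  have hbound : (k : ℝ) / ε * Real.log r + 1 / ε * Real.log (1 / δ) = L / ε := by
    rw [hL]
    field_simp
  rw [hbound]
  have hklog : Real.log r ≤ k * Real.log r := le_mul_of_one_le_left (by linarith) hk1
  have hL0 : 0 < L := by linarith
  rcases le_or_gt (c * (ε * n)) L with hbig | hsmall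
  · refine ⟨n, ?_, _, coordinateSystem_self_solvesSpiked hkn hε.le hδ.le⟩
    have h2 : (n : ℝ) ≤ 1 / c * (L / ε) := by
      rw [one_div_mul_eq_div, le_div_iff₀ hc0, le_div_iff₀ hε]
      linarith
    have h3 : 0 ≤ L / ε := by positivity
    linarith
  -- If `r < 4`, then `log r < c r < log (1/β)`, contradicting `r ≥ 1/β`.
  have hr4 : 4 ≤ r := by
    have h2 : k * Real.log r < k * (c * r) := by
      calc k * Real.log r < L := by linarith
        _ < c * (ε * n) := hsmall
        _ = k * (c * r) := by rw [← hkr]; ring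
    have h3 : Real.log r < c * r := lt_of_mul_lt_mul_left h2 hk0.le
    have h4 : c * r ≤ Real.log (1 / β) / 4 * r := by gcongr
    by_contra h
    nlinarith
  have hl1 : 1 ≤ Real.log r := by
    rw [Real.le_log_iff_exp_le hr0]
    linarith [Real.exp_one_lt_d9]
  have hkL : k ≤ L := by nlinarith
  have hLn : 10241 * L ≤ ε * n := by
    have : c * (ε * n) ≤ 1 / 10241 * (ε * n) := by gcongr
    linarith
  have hL1 : 1 ≤ L := hk1.trans hkL
  have hLε : L ≤ L / ε := by
    rw [le_div_iff₀ hε]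
    nlinarith
  -- `e^{-L} ≤ δ/r`, and `r ≥ 4` absorbs the four bad events.
  have hexp : 4 * Real.exp (-L) ≤ δ := by
    have h2 : Real.exp (-L) ≤ Real.exp (-Real.log r) * Real.exp (-Real.log (1 / δ)) := by
      rw [← Real.exp_add]
      exact Real.exp_le_exp.2 (by linarith)
    rw [Real.exp_neg (Real.log r), Real.exp_neg (Real.log (1 / δ)), Real.exp_log hr0,
      Real.exp_log (by positivity), one_div, inv_inv] at h2
    have h3 : r⁻¹ ≤ 1 / 4 := by
      rw [one_div]
      exact inv_anti₀ (by norm_num) hr4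
    have h4 : r⁻¹ * δ ≤ 1 / 4 * δ := by gcongr
    linarith
  have hlogn : Real.log (n / k) = Real.log r - Real.log ε := by
    rw [← Real.log_div hr0.ne' hε.ne', hr]
    congr 1
    field_simp
  -- Rounding up costs at most `1 ≤ L/ε`.
  obtain ⟨m, hm1, hm2⟩ : ∃ m : ℕ, 10240 * (L / ε) ≤ m ∧ (m : ℝ) ≤ 10241 * (L / ε) := by
    refine ⟨⌈10240 * (L / ε)⌉₊, Nat.le_ceil _, ?_⟩
    have := (Nat.ceil_lt_add_one (show 0 ≤ 10240 * (L / ε) by positivity)).le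
    linarith
  refine ⟨m, ?_, ?_⟩
  · have h3 : 0 ≤ 1 / c * (L / ε) := by positivity
    linarith
  rcases le_total 1 (ε * r) with hB | hA
  · obtain ⟨A, hA⟩ := exists_solvesSpiked_of_gaussianMatrix (n := n) (k := k) (m := m) (L := L)
      hk hkn hε hε1
      (by
        have h2 : 0 ≤ Real.log ε + Real.log r := by
          rw [← Real.log_mul hε.ne' hr0.ne']
          exact Real.log_nonneg hB
        rw [hlogn]
        nlinarith)
      (by linarith)
      (by
        have := mul_le_mul_of_nonneg_right hm1 hε.le
        rwa [mul_assoc, div_mul_cancel₀ _ hε.ne'] at this)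
    exact ⟨A, hA.mono hexp⟩
  · have hmn : m ≤ n := by
      have h2 : 10241 * (L / ε) ≤ n := by
        rw [← mul_div_assoc, div_le_iff₀ hε]
        linarith
      exact Nat.cast_le.1 (hm2.trans h2)
    have hkm : 2 * k ≤ m := by
      have : (2 : ℝ) * k ≤ m := by linarith
      exact_mod_cast this
    have hkε : k / ε ≤ L / ε := by gcongr
    have hεn : ε * n ≤ L / ε := by
      refine le_trans ?_ hkε
      rw [← hkr, le_div_iff₀ hε, mul_assoc, mul_comm r]
      exact mul_le_of_le_one_right hk0.le hA
    -- Here `log (1/ε)` is not controlled by `log r`, but `k log (1/ε) ≤ k/ε` fits in the budget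
    -- `L/ε`.
    have hN : k * (Real.log (n / k) + 2) ≤ 4 * (L / ε) := by
      have h2 : -Real.log ε ≤ 1 / ε := by
        rw [← Real.log_inv, one_div]
        exact (Real.log_le_sub_one_of_pos (by positivity)).trans (by linarith)
      have h3 : k * (-Real.log ε) ≤ k / ε := by
        rw [div_eq_mul_one_div]
        gcongr
      rw [hlogn]
      linarith
    exact ⟨_, (coordinateSystem_solvesSpiked_of_le hmn hk hkm hε.le (L := L) (by linarith)
      (by linarith)).mono (by linarith [Real.exp_pos (-L)])⟩
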